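/- Let $K\subset\mathbb R^N$ be a convex body (compact, convex, with nonempty interior), let $\varphi_1,\dots,\varphi_n$ be real functions, each analytic in a neighbourhood of every point of $K$, that are linearly independent on $K$, let $\mathcal P=\operatorname{span}\{\varphi_1,\dots,\varphi_n\}$, and let $f:K\to\mathbb R$ be Lipschitz. For $q=\sum_i q^i\varphi_i\in\mathcal P$ write $\boldsymbol q=(q^1,\dots,q^n)$, let $u(t)=(\varphi_1(t),\dots,\varphi_n(t))$, and let $\|\cdot\|$ be the uniform norm on $K$. A point $t$ is a zero of multiplicity $k\ge1$ of $q$ if all derivatives of $q$ of order less than $k$ vanish at $t$ and the derivative of order $k$ does not. Let $m$ be the maximal multiplicity of the zeros in $K$ of the nonzero elements of $\mathcal P$ ($m=0$ if there are no zeros). A *step* consists of points $t_1,\dots,t_{n+1}\in K$, signs $\sigma_i\in\{-1,1\}$, a polynomial $p\in\mathcal P$ and a number $d\ge0$ such that every $n$ of the vectors $a_i=\sigma_iu(t_i)$, $i=1,\dots,n+1$, are linearly independent and $p(t_i)-f(t_i)=\sigma_id$ for all $i$. For a step put $r=\|p-f\|$. For $i_1<i_2$ let $q_{i_1i_2}\in\mathcal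 P$ be the polynomial, unique up to sign, with $\|\boldsymbol q_{i_1i_2}\|_2=1$ and $q_{i_1i_2}(t_s)=0$ for all $s\notin\{i_1,i_2\}$, and put $$g(t)=\sum_{i_1<i_2}\frac1{|q_{i_1i_2}(t)|^2}\in[0,\infty]\qquad(1/0=\infty).$$ For $\nu\in(0,1)$ let $t_\nu$ be a point of minimum of $g$ on the set $\{t\in K:\ |p(t)-f(t)|\ge(1-\nu)r+\nu d\}$. **Proposition.** Fix $\nu\in(0,1)$. Then $m$ is finite, $t_\nu$ exists for every step, and $g(t_\nu)=O(|r-d|^{-2m})$ in the following sense. 1. For every $\rho$ there is a constant $C$, depending only on $K,\varphi_1,\dots,\varphi_n,f,\nu,\rho$, such that $g(t_\nu)\le C\,|r-d|^{-2m}$ for every step with $d<r\le\rho$ and every such $t_\nu$. 2. For every $\delta$ there is a constant $C$, depending only on $K,\varphi_1,\dots,\varphi_n,f,\nu,\delta$, such that $g(t_\nu)\le C\,|r-d|^{-2m}$ for every step with $0<r-d\le\delta$ for which the convex hull of $a_1,\dots,a_{n+1}$ contains the origin (as it does in every iteration of the generalized Remez algorithm), and every such $t_\nu$. -/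

import Mathlib

open scoped ENNReal

noncomputable section

/-- The polynomial by the system `φ` with coefficient vector `c`. -/
def sysPoly {N n : ℕ} (φ : Fin n → EuclideanSpace ℝ (Fin N) → ℝ)
    (c : EuclideanSpace ℝ (Fin n)) (x : EuclideanSpace ℝ (Fin N)) : ℝ :=
  ∑ i, c i * φ i x

/-- The moment vector `u(x) = (φ₁(x), …, φₙ(x))`. -/
def momentVec {N n : ℕ} (φ : Fin n → EuclideanSpace ℝ (Fin N) → ℝ)
    (x : EuclideanSpace ℝ (Fin N)) : EuclideanSpace ℝ (Fin n) :=
  WithLp.toLp 2 fun i => φ i x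

/-- The uniform norm of `h` on `K`. -/
def uniformNormOn {N : ℕ} (K : Set (EuclideanSpace ℝ (Fin N)))
    (h : EuclideanSpace ℝ (Fin N) → ℝ) : ℝ :=
  sSup ((fun x => |h x|) '' K)

/-- A system of vectors in `ℝⁿ` is nondegenerate if every `n` of them are linearly independent. -/
def NondegenerateSystem {ι : Type*} {n : ℕ} (a : ι → EuclideanSpace ℝ (Fin n)) : Prop :=
  ∀ s : Finset ι, s.card = n → LinearIndependent ℝ fun i : s => a i

/-- `x` is a zero of `F` of multiplicity `k ≥ 1`: all derivatives of order less than `k`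
vanish at `x`, and the derivative of order `k` does not. -/
def IsZeroOfMultiplicity {N : ℕ} (F : EuclideanSpace ℝ (Fin N) → ℝ)
    (x : EuclideanSpace ℝ (Fin N)) (k : ℕ) : Prop :=
  0 < k ∧ (∀ j < k, iteratedFDeriv ℝ j F x = 0) ∧ iteratedFDeriv ℝ k F x ≠ 0

/-- The multiplicities of the zeros on `K` of the nonzero polynomials by the system `φ`. -/
def zeroMultiplicities {N n : ℕ} (K : Set (EuclideanSpace ℝ (Fin N)))
    (φ : Fin n → EuclideanSpace ℝ (Fin N) → ℝ) : Set ℕ :=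
  {k | ∃ c : EuclideanSpace ℝ (Fin n), c ≠ 0 ∧ ∃ x ∈ K, IsZeroOfMultiplicity (sysPoly φ c) x k}

/-- The maximal multiplicity of zeros on `K` of nonzero polynomials by the system `φ`
(`0` if there are no zeros). -/
def maxZeroMultiplicity {N n : ℕ} (K : Set (EuclideanSpace ℝ (Fin N)))
    (φ : Fin n → EuclideanSpace ℝ (Fin N) → ℝ) : ℕ :=
  sSup (zeroMultiplicities K φ)

/-- The data of one step: nodes `t₁, …, tₙ₊₁ ∈ K`, signs `σᵢ`, a polynomial with coefficient
vector `p` and a number `d ≥ 0` such that `p(tᵢ) - f(tᵢ) = σᵢ d` and the oriented moment vectors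
`σᵢ u(tᵢ)` form a nondegenerate system. -/
structure IsStepData {N n : ℕ} (K : Set (EuclideanSpace ℝ (Fin N)))
    (φ : Fin n → EuclideanSpace ℝ (Fin N) → ℝ) (f : EuclideanSpace ℝ (Fin N) → ℝ)
    (t : Fin (n + 1) → EuclideanSpace ℝ (Fin N)) (σ : Fin (n + 1) → ℝ)
    (p : EuclideanSpace ℝ (Fin n)) (d : ℝ) : Prop where
  mem : ∀ i, t i ∈ K
  sign : ∀ i, σ i = 1 ∨ σ i = -1
  nonneg : 0 ≤ d
  nondegenerate : NondegenerateSystem fun i => σ i • momentVec φ (t i)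
  interpolates : ∀ i, sysPoly φ p (t i) - f (t i) = σ i * d

/-- `q i₁ i₂`, for `i₁ < i₂`, is the coefficient vector, of Euclidean norm `1`, of a polynomial
that vanishes at all the nodes `t s` with `s ∉ {i₁, i₂}`. -/
def IsNodalFamily {N n : ℕ} (φ : Fin n → EuclideanSpace ℝ (Fin N) → ℝ)
    (t : Fin (n + 1) → EuclideanSpace ℝ (Fin N))
    (q : Fin (n + 1) → Fin (n + 1) → EuclideanSpace ℝ (Fin n)) : Prop :=
  ∀ i₁ i₂, i₁ < i₂ →
    ‖q i₁ i₂‖ = 1 ∧ ∀ s, s ≠ i₁ → s ≠ i₂ → sysPoly φ (q i₁ i₂) (t s) = 0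

/-- The objective `g(x) = ∑_{i₁ < i₂} 1 / |q_{i₁ i₂}(x)|²`, with `1 / 0 = ∞`. -/
def regObjective {N n : ℕ} (φ : Fin n → EuclideanSpace ℝ (Fin N) → ℝ)
    (q : Fin (n + 1) → Fin (n + 1) → EuclideanSpace ℝ (Fin n))
    (x : EuclideanSpace ℝ (Fin N)) : ℝ≥0∞ :=
  ∑ i : Fin (n + 1) × Fin (n + 1) with i.1 < i.2,
    (ENNReal.ofReal (|sysPoly φ (q i.1 i.2) x| ^ 2))⁻¹

/-- The feasible set `{x ∈ K : |p(x) - f(x)| ≥ (1 - ν) r + ν d}`. -/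
def regFeasible {N n : ℕ} (K : Set (EuclideanSpace ℝ (Fin N)))
    (φ : Fin n → EuclideanSpace ℝ (Fin N) → ℝ) (f : EuclideanSpace ℝ (Fin N) → ℝ)
    (p : EuclideanSpace ℝ (Fin n)) (ν r d : ℝ) : Set (EuclideanSpace ℝ (Fin N)) :=
  {x | x ∈ K ∧ (1 - ν) * r + ν * d ≤ |sysPoly φ p x - f x|}

/-- `x` solves the regularization problem: it minimizes `g` over the feasible set,
where `r = ‖p - f‖` on `K`. -/
def IsRegSolution {N n : ℕ} (K : Set (EuclideanSpace ℝ (Fin N)))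
    (φ : Fin n → EuclideanSpace ℝ (Fin N) → ℝ) (f : EuclideanSpace ℝ (Fin N) → ℝ)
    (p : EuclideanSpace ℝ (Fin n)) (d ν : ℝ)
    (q : Fin (n + 1) → Fin (n + 1) → EuclideanSpace ℝ (Fin n))
    (x : EuclideanSpace ℝ (Fin N)) : Prop :=
  x ∈ regFeasible K φ f p ν (uniformNormOn K fun y => sysPoly φ p y - f y) d ∧
    ∀ y ∈ regFeasible K φ f p ν (uniformNormOn K fun y => sysPoly φ p y - f y) d,
      regObjective φ q x ≤ regObjective φ q y

end

/-! Let `xm` maximize `|p - f|`. It suffices to find a feasible `y` close to `xm` at which every `q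
i₁ i₂` is at least of order `(r - d) ^ m`, since `g` at the minimizer is at most `g y`.

Such points exist on small scales. At each point of `K` a nonzero polynomial has a nonvanishing
derivative of some order `k ≤ m`. For finitely many polynomials, one direction into `K` serves them
all, and their directional derivatives stay at least `lam` on a short segment. By iterated mean
values, each polynomial is small at fewer than `2 ^ k` of the equally spaced points of the segment,
so with enough points one is good for all. Compactness of (unit spheres) × `K` makes the constants
uniform: `exists_forall_exists_le_abs_sysPoly`.

On steps with `r ≤ ρ` the coefficients of `p` are bounded, so `p - f` has a uniform Lipschitz
constant. At distance `O(r - d)` from `xm`, with a small enough constant, `|p - f|` drops by at most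
`ν (r - d)`, so `y` is feasible. If the origin lies in the convex hull, then `d ≤ max |f|`, so a
bound on `r - d` bounds `r`. -/

open Set Filter Topology

/-! ### Derivatives of analytic functions and their diagonals -/

section Analytic

variable {E F : Type*} [NormedAddCommGroup E] [NormedSpace ℝ E]
  [NormedAddCommGroup F] [NormedSpace ℝ F]

/-- An analytic function all of whose derivatives vanish at a point vanishes near that point. -/
theorem AnalyticAt.eventuallyEq_zero_of_iteratedFDeriv_eq_zero [CompleteSpace F]
    {f : E → F} {x : E}
    (hf : AnalyticAt ℝ f x) (h : ∀ k, iteratedFDeriv ℝ k f x = 0) : f =ᶠ[𝓝 x] 0 := by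
  obtain ⟨p, r, hp⟩ := hf
  have hball : Metric.eball x r ∈ 𝓝 x := Metric.eball_mem_nhds x hp.r_pos
  filter_upwards [hball] with y hy
  have hy' : y - x ∈ Metric.eball (0 : E) r := by
    simpa [edist_eq_enorm_sub] using hy
  have hs := hp.hasSum_iteratedFDeriv hy'
  simp only [h, zero_apply, smul_zero, add_sub_cancel] at hs
  exact hs.unique hasSum_zero

/-- A nonzero iterated derivative of an analytic function does not vanish on the diagonal. -/
theorem ContDiffAt.exists_iteratedFDeriv_diag_ne_zero {f : E → F} {x : E}
    (hf : ContDiffAt ℝ ⊤ f x) {k : ℕ} (h : iteratedFDeriv ℝ k f x ≠ 0) :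
    ∃ v : E, iteratedFDeriv ℝ k f x (fun _ => v) ≠ 0 := by
  by_contra! hv
  apply h
  ext v
  -- Polarization: the `k`-th derivative of the diagonal form sums over permutations, which by
  -- symmetry gives `k!` times the value at `v`.
  have key := (iteratedFDeriv ℝ k f x).iteratedFDeriv_comp_diagonal 0 v
  have hsym : ∀ σ : Equiv.Perm (Fin k),
      iteratedFDeriv ℝ k f x (fun i => v (σ i)) = iteratedFDeriv ℝ k f x v :=
    fun σ => hf.iteratedFDeriv_comp_perm v σ
  have h0 : (fun y : E => iteratedFDeriv ℝ k f x fun _ => y) = fun _ => 0 := funext hv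
  rw [h0] at key
  simp only [hsym, Finset.sum_const, Finset.card_univ, Fintype.card_perm, Fintype.card_fin] at key
  have hz : iteratedFDeriv ℝ k (fun _ : E => (0 : F)) 0 v = 0 := by
    rw [iteratedFDeriv_fun_zero]; rfl
  rw [hz, eq_comm, ← Nat.cast_smul_eq_nsmul ℝ, smul_eq_zero] at key
  rcases key with key | key
  · exact absurd key (by exact_mod_cast k.factorial_ne_zero)
  · simpa using key

theorem ContinuousMultilinearMap.analyticOnNhd_diag_sub {k : ℕ} (M : E [×k]→L[ℝ] F) (x : E) :
    AnalyticOnNhd ℝ (fun z : E => M fun _ => z - x) univ := by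
  have h : AnalyticOnNhd ℝ (fun z : E => fun _ : Fin k => z - x) univ :=
    fun z _ => AnalyticAt.pi fun _ => analyticAt_id.sub analyticAt_const
  exact M.analyticOnNhd.comp h (mapsTo_univ _ _)

/-- Finitely many multilinear maps, none of which vanishes identically on the diagonal, are all
nonzero at a common diagonal vector that points from `x` to a given open set. -/
theorem exists_forall_diag_ne_zero [CompleteSpace E] {ι : Type*} [Finite ι] {k : ι → ℕ}
    (M : ∀ i, E [×k i]→L[ℝ] F) (hM : ∀ i, ∃ v, M i (fun _ => v) ≠ 0) (x : E) {W : Set E}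
    (hW : IsOpen W) (hne : W.Nonempty) : ∃ z ∈ W, ∀ i, M i (fun _ => z - x) ≠ 0 := by
  have hopen : ∀ i, IsOpen {z | M i (fun _ => z - x) ≠ 0} := fun i =>
    isOpen_ne_fun (by fun_prop) continuous_const
  -- By the identity theorem the zero set of a nonzero diagonal form has empty interior.
  have hdense : ∀ i, Dense {z | M i (fun _ => z - x) ≠ 0} := by
    intro i
    rw [dense_iff_inter_open]
    rintro V hV ⟨z, hz⟩
    by_contra hcon
    have hzero : (fun z : E => M i fun _ => z - x) =ᶠ[𝓝 z] 0 := by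
      filter_upwards [hV.mem_nhds hz] with y hy
      by_contra hy'
      exact hcon ⟨y, hy, hy'⟩
    obtain ⟨v, hv⟩ := hM i
    have := ((M i).analyticOnNhd_diag_sub x).eqOn_zero_of_preconnected_of_eventuallyEq_zero
      isPreconnected_univ (mem_univ z) hzero (mem_univ (x + v))
    exact hv (by simpa using this)
  obtain ⟨z, hzW, hz⟩ := (dense_iInter_of_isOpen hopen hdense).inter_open_nonempty W hW hne
  exact ⟨z, hzW, fun i => mem_iInter.1 hz i⟩

/-- The derivatives along a segment of the iterated derivatives of `f`. -/
theorem hasDerivAt_iteratedFDeriv_comp_line {f : E → F} {x v : E} {s : ℝ}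
    (hf : ContDiffAt ℝ ⊤ f (x + s • v)) (k : ℕ) :
    HasDerivAt (fun s : ℝ => iteratedFDeriv ℝ k f (x + s • v) fun _ => v)
      (iteratedFDeriv ℝ (k + 1) f (x + s • v) fun _ => v) s := by
  have hd : DifferentiableAt ℝ (iteratedFDeriv ℝ k f) (x + s • v) :=
    hf.differentiableAt_iteratedFDeriv (WithTop.coe_lt_top _)
  have hl : HasDerivAt (fun s : ℝ => x + s • v) v s := by
    simpa using ((hasDerivAt_id s).smul_const v).const_add x
  have h1 := hd.hasFDerivAt.comp_hasDerivAt s hl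
  have h2 := (ContinuousMultilinearMap.apply ℝ (fun _ : Fin k => E) F
    (fun _ => v)).hasFDerivAt.comp_hasDerivAt s h1
  exact h2

end Analytic

/-! ### Lower bounds in one variable -/

/-- If the `k`-th derivative of `g 0` is at least `lam` in absolute value, then among any `2 ^ k`
points with gaps at least `δ` there is one where `g 0` is not small. -/
theorem exists_le_abs_of_iterated_deriv {a b lam δ : ℝ} (hδ : 0 < δ) :
    ∀ (k : ℕ) (g : ℕ → ℝ → ℝ), (∀ i, ∀ s ∈ Icc a b, HasDerivAt (g i) (g (i + 1) s) s) →
      (∀ s ∈ Icc a b, lam ≤ |g k s|) → ∀ s : ℕ → ℝ, (∀ i < 2 ^ k, s i ∈ Icc a b) →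
      (∀ i, i + 1 < 2 ^ k → s i + δ ≤ s (i + 1)) →
      ∃ i < 2 ^ k, lam * (δ / 2) ^ k ≤ |g 0 (s i)| := by
  intro k
  induction k with
  | zero =>
    intro g _ hlam s hs _
    exact ⟨0, by simp, by simpa using hlam _ (hs 0 (by simp))⟩
  | succ k ih =>
    intro g hg hlam s hs hgap
    have hpow : 2 ^ (k + 1) = 2 * 2 ^ k := by ring
    -- Mean value points of disjoint consecutive pairs: each gap between them contains a gap of `s`,
    -- so the `2 ^ k` points `ξ j` again have gaps at least `δ`. The value for `j ≥ 2 ^ k` is a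
    -- dummy.
    have hξ : ∀ j, ∃ ξ, j < 2 ^ k → ξ ∈ Ioo (s (2 * j)) (s (2 * j + 1)) ∧
        g 1 ξ = (g 0 (s (2 * j + 1)) - g 0 (s (2 * j))) / (s (2 * j + 1) - s (2 * j)) := by
      intro j
      by_cases hj : j < 2 ^ k
      · have h0 := hs (2 * j) (by omega)
        have h1 := hs (2 * j + 1) (by omega)
        have hg1 := hgap (2 * j) (by omega)
        have hsub : ∀ y ∈ Icc (s (2 * j)) (s (2 * j + 1)), y ∈ Icc a b :=
          fun y hy => ⟨h0.1.trans hy.1, hy.2.trans h1.2⟩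
        obtain ⟨ξ, hξ, he⟩ := exists_hasDerivAt_eq_slope (g 0) (g 1)
          (show s (2 * j) < s (2 * j + 1) by linarith)
          (fun y hy => (hg 0 y (hsub y hy)).continuousAt.continuousWithinAt)
          (fun y hy => hg 0 y (hsub y (Ioo_subset_Icc_self hy)))
        exact ⟨ξ, fun _ => ⟨hξ, he⟩⟩
      · exact ⟨0, fun h => absurd h hj⟩
    choose ξ hξ using hξ
    obtain ⟨j, hj, hle⟩ := ih (fun i => g (i + 1)) (fun i => hg (i + 1)) hlam ξ
      (fun i hi => ⟨(hs (2 * i) (by omega)).1.trans (hξ i hi).1.1.le,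
        (hξ i hi).1.2.le.trans (hs (2 * i + 1) (by omega)).2⟩)
      (fun i hi => by
        have h1 := (hξ i (by omega)).1.2
        have h2 := (hξ (i + 1) hi).1.1
        have h3 := hgap (2 * i + 1) (by omega)
        rw [show 2 * (i + 1) = 2 * i + 1 + 1 by ring] at h2
        linarith)
    have hgj := hgap (2 * j) (by omega)
    simp only [zero_add, (hξ j hj).2, abs_div] at hle
    rw [abs_of_pos (show 0 < s (2 * j + 1) - s (2 * j) by linarith),
      le_div_iff₀ (by linarith)] at hle
    have htri := abs_sub (g 0 (s (2 * j + 1))) (g 0 (s (2 * j)))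
    by_contra! hcon
    have hc0 := hcon (2 * j) (by omega)
    have hc1 := hcon (2 * j + 1) (by omega)
    -- The sign of `lam` is not assumed; a strict upper bound on an absolute value forces
    -- positivity.
    have hpos : 0 < lam * (δ / 2) ^ k := by
      have : 0 < lam * (δ / 2) ^ (k + 1) := (abs_nonneg _).trans_lt hc0
      rw [pow_succ, ← mul_assoc] at this
      exact pos_of_mul_pos_left this (by positivity)
    have hmul : lam * (δ / 2) ^ k * δ ≤ lam * (δ / 2) ^ k * (s (2 * j + 1) - s (2 * j)) :=
      mul_le_mul_of_nonneg_left (by linarith) hpos.le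
    rw [pow_succ] at hc0 hc1
    nlinarith

/-! ### Multiplicities of zeros of polynomials by the system -/

section System

variable {N n : ℕ} {K : Set (EuclideanSpace ℝ (Fin N))} {φ : Fin n → EuclideanSpace ℝ (Fin N) → ℝ}

theorem analyticOnNhd_sysPoly (hφ : ∀ i, AnalyticOnNhd ℝ (φ i) K) (c : EuclideanSpace ℝ (Fin n)) :
    AnalyticOnNhd ℝ (sysPoly φ c) K := fun x hx =>
  Finset.analyticAt_fun_sum _ fun i _ => analyticAt_const.mul (hφ i x hx)

theorem iteratedFDeriv_sysPoly (hφ : ∀ i, AnalyticOnNhd ℝ (φ i) K)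
    (c : EuclideanSpace ℝ (Fin n)) (k : ℕ) {x : EuclideanSpace ℝ (Fin N)} (hx : x ∈ K) :
    iteratedFDeriv ℝ k (sysPoly φ c) x = ∑ i, c i • iteratedFDeriv ℝ k (φ i) x := by
  have h : sysPoly φ c = fun y => ∑ i, c i • φ i y := by
    ext y; simp [sysPoly]
  rw [h, iteratedFDeriv_fun_sum_apply (f := fun i y => c i • φ i y)
    (fun i _ => (hφ i x hx).contDiffAt.const_smul (c i))]
  exact Finset.sum_congr rfl fun i _ =>
    iteratedFDeriv_const_smul_apply' (hφ i x hx).contDiffAt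

theorem continuousOn_iteratedFDeriv_sysPoly (hφ : ∀ i, AnalyticOnNhd ℝ (φ i) K) (k : ℕ) :
    ContinuousOn (fun z : EuclideanSpace ℝ (Fin n) × EuclideanSpace ℝ (Fin N) =>
      iteratedFDeriv ℝ k (sysPoly φ z.1) z.2) (univ ×ˢ K) := by
  have h : ContinuousOn (fun z : EuclideanSpace ℝ (Fin n) × EuclideanSpace ℝ (Fin N) =>
      ∑ i, z.1 i • iteratedFDeriv ℝ k (φ i) z.2) (univ ×ˢ K) := by
    refine continuousOn_finsetSum _ fun i _ => ContinuousOn.smul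
      (f := fun z : EuclideanSpace ℝ (Fin n) × EuclideanSpace ℝ (Fin N) => z.1 i)
      (Continuous.continuousOn (by fun_prop)) ?_
    exact ((hφ i).iteratedFDeriv k).continuousOn.comp continuousOn_snd fun z hz => hz.2
  exact h.congr fun z hz => iteratedFDeriv_sysPoly hφ z.1 k hz.2

theorem sysPoly_eq_zero_of_eqOn (hindep : LinearIndependent ℝ fun (i : Fin n) (x : K) => φ i x)
    {c : EuclideanSpace ℝ (Fin n)} (h : EqOn (sysPoly φ c) 0 K) : c = 0 := by
  ext i
  refine Fintype.linearIndependent_iff.1 hindep (fun i => c i) ?_ i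
  ext x
  simpa [sysPoly] using h x.2

theorem exists_iteratedFDeriv_sysPoly_ne_zero (hKconv : Convex ℝ K)
    (hφ : ∀ i, AnalyticOnNhd ℝ (φ i) K)
    (hindep : LinearIndependent ℝ fun (i : Fin n) (x : K) => φ i x)
    {c : EuclideanSpace ℝ (Fin n)} (hc : c ≠ 0) {x : EuclideanSpace ℝ (Fin N)} (hx : x ∈ K) :
    ∃ k, iteratedFDeriv ℝ k (sysPoly φ c) x ≠ 0 := by
  by_contra! h
  have ha := analyticOnNhd_sysPoly hφ c
  exact hc (sysPoly_eq_zero_of_eqOn hindep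
    (ha.eqOn_zero_of_preconnected_of_eventuallyEq_zero hKconv.isPreconnected hx
      ((ha x hx).eventuallyEq_zero_of_iteratedFDeriv_eq_zero h)))

/-- A nonvanishing derivative of fixed order persists nearby, so finitely many orders cover the
compact set (unit sphere) × `K`; scaling handles all nonzero coefficients. -/
theorem bddAbove_zeroMultiplicities (hKconv : Convex ℝ K) (hKcomp : IsCompact K)
    (hφ : ∀ i, AnalyticOnNhd ℝ (φ i) K)
    (hindep : LinearIndependent ℝ fun (i : Fin n) (x : K) => φ i x) :
    BddAbove (zeroMultiplicities K φ) := by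
  have key : ∃ M : ℕ, ∀ z ∈ Metric.sphere (0 : EuclideanSpace ℝ (Fin n)) 1 ×ˢ K,
      ∃ k ≤ M, iteratedFDeriv ℝ k (sysPoly φ z.1) z.2 ≠ 0 := by
    refine ((isCompact_sphere (0 : EuclideanSpace ℝ (Fin n)) 1).prod hKcomp).induction_on
      (p := fun s => ∃ M : ℕ, ∀ z ∈ s, ∃ k ≤ M, iteratedFDeriv ℝ k (sysPoly φ z.1) z.2 ≠ 0)
      ⟨0, by simp⟩ ?_ ?_ ?_
    · rintro s t hst ⟨M, hM⟩
      exact ⟨M, fun z hz => hM z (hst hz)⟩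
    · rintro s t ⟨M, hM⟩ ⟨M', hM'⟩
      refine ⟨max M M', ?_⟩
      rintro z (hz | hz)
      · obtain ⟨k, hk, h⟩ := hM z hz
        exact ⟨k, hk.trans (le_max_left _ _), h⟩
      · obtain ⟨k, hk, h⟩ := hM' z hz
        exact ⟨k, hk.trans (le_max_right _ _), h⟩
    · rintro z ⟨hz1, hz2⟩
      have hz0 : z.1 ≠ 0 := Metric.ne_of_mem_sphere hz1 one_ne_zero
      obtain ⟨k, hk⟩ := exists_iteratedFDeriv_sysPoly_ne_zero hKconv hφ hindep hz0 hz2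
      refine ⟨{y | iteratedFDeriv ℝ k (sysPoly φ y.1) y.2 ≠ 0}, ?_, k, fun y hy => ⟨k, le_rfl, hy⟩⟩
      have hcont := (continuousOn_iteratedFDeriv_sysPoly hφ k).mono
        (prod_mono_left (subset_univ (Metric.sphere (0 : EuclideanSpace ℝ (Fin n)) 1)))
      exact (hcont z ⟨hz1, hz2⟩).eventually_ne hk
  obtain ⟨M, hM⟩ := key
  refine ⟨M, ?_⟩
  rintro k ⟨c, hc, x, hx, -, hlow, -⟩
  obtain ⟨j, hj, hne⟩ := hM (‖c‖⁻¹ • c, x)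
    ⟨by simp [norm_smul, inv_mul_cancel₀ (norm_ne_zero_iff.2 hc)], hx⟩
  by_contra! hlt
  apply hne
  have h0 := hlow j (hj.trans_lt hlt)
  rw [iteratedFDeriv_sysPoly hφ _ _ hx] at h0 ⊢
  simp only [PiLp.smul_apply, smul_eq_mul, mul_smul, ← Finset.smul_sum, h0, smul_zero]

/-- The least order of a nonvanishing derivative is either `0` or the multiplicity of a zero. -/
theorem exists_le_maxZeroMultiplicity_diag_ne_zero (hKconv : Convex ℝ K) (hKcomp : IsCompact K)
    (hφ : ∀ i, AnalyticOnNhd ℝ (φ i) K)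
    (hindep : LinearIndependent ℝ fun (i : Fin n) (x : K) => φ i x)
    {c : EuclideanSpace ℝ (Fin n)} (hc : c ≠ 0) {x : EuclideanSpace ℝ (Fin N)} (hx : x ∈ K) :
    ∃ k ≤ maxZeroMultiplicity K φ, ∃ v, iteratedFDeriv ℝ k (sysPoly φ c) x (fun _ => v) ≠ 0 := by
  classical
  have hex := exists_iteratedFDeriv_sysPoly_ne_zero hKconv hφ hindep hc hx
  refine ⟨Nat.find hex, ?_, (analyticOnNhd_sysPoly hφ c x hx).contDiffAt
    |>.exists_iteratedFDeriv_diag_ne_zero (Nat.find_spec hex)⟩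
  rcases Nat.eq_zero_or_pos (Nat.find hex) with h0 | hpos
  · simp [h0]
  · exact le_csSup (bddAbove_zeroMultiplicities hKconv hKcomp hφ hindep)
      ⟨c, hc, x, hx, hpos, fun j hj => not_not.1 (Nat.find_min hex hj), Nat.find_spec hex⟩

end System

/-! ### A common good point by pigeonhole -/

/-- Finitely many functions on `[0, h]`, each with a derivative of order at most `m` bounded away
from zero, are simultaneously not small at some point. -/
theorem exists_forall_le_abs_of_iterated_deriv {ι : Type*} [Fintype ι] {m : ℕ} {h lam : ℝ}
    (hh : 0 < h) (g : ι → ℕ → ℝ → ℝ) (k : ι → ℕ) (hk : ∀ i, k i ≤ m)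
    (hg : ∀ i j, ∀ s ∈ Icc 0 h, HasDerivAt (g i j) (g i (j + 1) s) s)
    (hlam : ∀ i, ∀ s ∈ Icc 0 h, lam ≤ |g i (k i) s|) :
    ∃ s ∈ Icc 0 h, ∀ i,
      lam * (h / (2 * ((Fintype.card ι * 2 ^ m + 1 : ℕ) : ℝ))) ^ k i ≤ |g i 0 s| := by
  classical
  set L : ℕ := Fintype.card ι * 2 ^ m + 1 with hL
  have hLpos : (0 : ℝ) < L := by positivity
  by_contra! hcon
  have hmem : ∀ j : ℕ, j < L → (j : ℝ) * (h / L) ∈ Icc 0 h := fun j hj => by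
    refine ⟨by positivity, ?_⟩
    have : (j : ℝ) ≤ L := by exact_mod_cast hj.le
    calc (j : ℝ) * (h / L) ≤ L * (h / L) := by gcongr
      _ = h := by field_simp
  have hsmall : ∀ j : Fin L, ∃ i, |g i 0 (j * (h / L))| < lam * (h / (2 * (L : ℝ))) ^ k i :=
    fun j => hcon _ (hmem j j.2)
  choose i₀ hi₀ using hsmall
  -- With `L > card ι * 2 ^ m` grid points, some function is small at more than `2 ^ m ≥ 2 ^ k i` of
  -- them, contradicting the one-function bound.
  obtain ⟨i, -, hi⟩ := Finset.exists_lt_card_fiber_of_mul_lt_card_of_maps_to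
    (s := (Finset.univ : Finset (Fin L))) (t := (Finset.univ : Finset ι)) (f := i₀) (n := 2 ^ m)
    (fun _ _ => Finset.mem_univ _) (by simp [hL])
  set T : Finset (Fin L) := Finset.univ.filter fun j => i₀ j = i with hT
  have hcard : 2 ^ k i ≤ T.card :=
    (Nat.pow_le_pow_right (by norm_num) (hk i)).trans hi.le
  let e := T.orderEmbOfCardLe hcard
  have heT : ∀ j, e j ∈ T := T.orderEmbOfCardLe_mem hcard
  obtain ⟨j, hj, hle⟩ := exists_le_abs_of_iterated_deriv (δ := h / L) (by positivity) (k i) (g i)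
    (hg i) (hlam i) (fun j => if hj : j < 2 ^ k i then (e ⟨j, hj⟩ : ℕ) * (h / L) else 0)
    (fun j hj => by simpa only [hj, dif_pos] using hmem _ (e ⟨j, hj⟩).2)
    (fun j hj => by
      have hlt : e ⟨j, by omega⟩ < e ⟨j + 1, hj⟩ := e.lt_iff_lt.2 (by simp)
      have hlt' : (((e ⟨j, by omega⟩ : Fin L) : ℕ) : ℝ) + 1 ≤ ((e ⟨j + 1, hj⟩ : Fin L) : ℕ) := by
        exact_mod_cast hlt
      simp only [hj, (show j < 2 ^ k i by omega), dif_pos]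
      have hp : 0 < h / L := by positivity
      nlinarith)
  simp only [hj, dif_pos] at hle
  have h1 := hi₀ (e ⟨j, hj⟩)
  rw [(Finset.mem_filter.1 (heT ⟨j, hj⟩)).2] at h1
  rw [div_div, mul_comm (L : ℝ)] at hle
  exact h1.not_ge hle

/-! ### Uniform lower bounds near every point of `K` -/

section System

variable {N n : ℕ} {K : Set (EuclideanSpace ℝ (Fin N))} {φ : Fin n → EuclideanSpace ℝ (Fin N) → ℝ}

/-- Near a given family of nonzero polynomials and a given point there are a common direction into
`K` and orders of differentiation for which the directional derivatives are bounded away from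
zero. -/
theorem exists_eventually_le_abs_iteratedFDeriv (hKconv : Convex ℝ K) (hKcomp : IsCompact K)
    (hKint : (interior K).Nonempty) (hφ : ∀ i, AnalyticOnNhd ℝ (φ i) K)
    (hindep : LinearIndependent ℝ fun (i : Fin n) (x : K) => φ i x) {ι : Type*} [Fintype ι]
    {q₀ : ι → EuclideanSpace ℝ (Fin n)} (hq₀ : ∀ i, q₀ i ≠ 0) {x₀ : EuclideanSpace ℝ (Fin N)}
    (hx₀ : x₀ ∈ K) :
    ∃ z ∈ K, ∃ k : ι → ℕ, (∀ i, k i ≤ maxZeroMultiplicity K φ) ∧ ∃ lam : ℝ, 0 < lam ∧ ∃ s₀ : ℝ, 0 < s₀ ∧ s₀ ≤ 1 ∧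
      ∀ᶠ a in 𝓝[univ ×ˢ K] (q₀, x₀), ∀ s ∈ Icc 0 s₀, ∀ i,
        lam ≤ |iteratedFDeriv ℝ (k i) (sysPoly φ (a.1 i)) (a.2 + s • (z - a.2))
          fun _ => z - a.2| := by
  choose k hkm hk using fun i =>
    exists_le_maxZeroMultiplicity_diag_ne_zero hKconv hKcomp hφ hindep (hq₀ i) hx₀
  obtain ⟨z, hz, hne⟩ := exists_forall_diag_ne_zero
    (fun i => iteratedFDeriv ℝ (k i) (sysPoly φ (q₀ i)) x₀) hk x₀ isOpen_interior hKint
  have hzK := interior_subset hz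
  obtain ⟨lam, hlam, hlam0⟩ : ∃ lam : ℝ, (∀ i, lam <
      |iteratedFDeriv ℝ (k i) (sysPoly φ (q₀ i)) x₀ fun _ => z - x₀|) ∧ 0 < lam := by
    have h1 : ∀ᶠ lam : ℝ in 𝓝[>] 0, ∀ i, lam <
        |iteratedFDeriv ℝ (k i) (sysPoly φ (q₀ i)) x₀ fun _ => z - x₀| :=
      eventually_all.2 fun i => nhdsWithin_le_nhds (Iio_mem_nhds (abs_pos.2 (hne i)))
    exact (h1.and self_mem_nhdsWithin).exists
  -- The segment parameter is a third variable: joint continuity at parameter `0` gives one length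
  -- `s₀` for all nearby polynomials and base points.
  have hev : ∀ i, ∀ᶠ b in 𝓝[(univ ×ˢ K) ×ˢ Icc (0 : ℝ) 1] ((q₀, x₀), (0 : ℝ)),
      lam < |iteratedFDeriv ℝ (k i) (sysPoly φ (b.1.1 i)) (b.1.2 + b.2 • (z - b.1.2))
          fun _ => z - b.1.2| := by
    intro i
    have hline : Continuous fun b : ((ι → EuclideanSpace ℝ (Fin n)) × EuclideanSpace ℝ (Fin N)) × ℝ =>
        (b.1.1 i, b.1.2 + b.2 • (z - b.1.2)) := by fun_prop
    have hmaps : MapsTo (fun b : ((ι → EuclideanSpace ℝ (Fin n)) × EuclideanSpace ℝ (Fin N)) × ℝ =>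
        (b.1.1 i, b.1.2 + b.2 • (z - b.1.2))) ((univ ×ˢ K) ×ˢ Icc (0 : ℝ) 1) (univ ×ˢ K) :=
      fun b hb => ⟨mem_univ _, hKconv.add_smul_sub_mem hb.1.2 hzK hb.2⟩
    have hcont := (continuousOn_iteratedFDeriv_sysPoly hφ (k i)).comp hline.continuousOn hmaps
    have hdir : Continuous fun b : ((ι → EuclideanSpace ℝ (Fin n)) × EuclideanSpace ℝ (Fin N)) × ℝ =>
        (fun _ : Fin (k i) => z - b.1.2) := by fun_prop
    have hfull : ContinuousOn
        (fun b : ((ι → EuclideanSpace ℝ (Fin n)) × EuclideanSpace ℝ (Fin N)) × ℝ =>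
          |iteratedFDeriv ℝ (k i) (sysPoly φ (b.1.1 i)) (b.1.2 + b.2 • (z - b.1.2))
            fun _ => z - b.1.2|) ((univ ×ˢ K) ×ˢ Icc (0 : ℝ) 1) :=
      (continuous_eval.comp_continuousOn (hcont.prodMk hdir.continuousOn)).abs
    refine (hfull ((q₀, x₀), 0) ⟨⟨mem_univ _, hx₀⟩, by simp⟩).eventually (lt_mem_nhds ?_)
    simpa using hlam i
  have hall := eventually_all.2 hev
  rw [nhdsWithin_prod_eq, eventually_prod_iff] at hall
  obtain ⟨pa, ha, ps, hs, hp⟩ := hall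
  obtain ⟨ε, hε, hball⟩ := Metric.mem_nhdsWithin_iff.1 hs
  refine ⟨z, hzK, k, hkm, lam, hlam0, min (ε / 2) 1, by positivity, min_le_right _ _, ?_⟩
  filter_upwards [ha] with a ha s hs i
  refine (hp ha (hball ⟨?_, hs.1, hs.2.trans (min_le_right _ _)⟩) i).le
  rw [Metric.mem_ball, Real.dist_eq, sub_zero, abs_of_nonneg hs.1]
  exact (hs.2.trans (min_le_left _ _)).trans_lt (half_lt_self hε)

/-- Within distance `O(h)` of any point of `K`, finitely many normalized polynomials are
simultaneously at least of order `h ^ m`, where `m` is the maximal multiplicity of zeros. -/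
theorem exists_forall_exists_le_abs_sysPoly (hKconv : Convex ℝ K) (hKcomp : IsCompact K)
    (hKint : (interior K).Nonempty) (hφ : ∀ i, AnalyticOnNhd ℝ (φ i) K)
    (hindep : LinearIndependent ℝ fun (i : Fin n) (x : K) => φ i x) (ι : Type*) [Fintype ι] :
    ∃ c : ℝ, 0 < c ∧ ∃ s₀ : ℝ, 0 < s₀ ∧ ∀ q : ι → EuclideanSpace ℝ (Fin n), (∀ i, ‖q i‖ = 1) →
      ∀ x ∈ K, ∀ h, 0 < h → h ≤ s₀ → ∃ y ∈ K, dist y x ≤ h * Metric.diam K ∧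
        ∀ i, c * h ^ maxZeroMultiplicity K φ ≤ |sysPoly φ (q i) y| := by
  set m := maxZeroMultiplicity K φ with hm
  have hcomp : IsCompact
      ((univ.pi fun _ : ι => Metric.sphere (0 : EuclideanSpace ℝ (Fin n)) 1) ×ˢ K) :=
    (isCompact_univ_pi fun _ => isCompact_sphere _ _).prod hKcomp
  -- Membership in `univ ×ˢ K` is a separate premise because the neighbourhoods in the compactness
  -- induction may contain points with second component outside `K`.
  have key : ∃ c : ℝ, 0 < c ∧ ∃ s₀ : ℝ, 0 < s₀ ∧
      ∀ a ∈ (univ.pi fun _ : ι => Metric.sphere (0 : EuclideanSpace ℝ (Fin n)) 1) ×ˢ K,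
      a ∈ (univ : Set (ι → EuclideanSpace ℝ (Fin n))) ×ˢ K →
      ∀ h, 0 < h → h ≤ s₀ → ∃ y ∈ K, dist y a.2 ≤ h * Metric.diam K ∧
        ∀ i, c * h ^ m ≤ |sysPoly φ (a.1 i) y| := by
    refine hcomp.induction_on (p := fun S => ∃ c : ℝ, 0 < c ∧ ∃ s₀ : ℝ, 0 < s₀ ∧ ∀ a ∈ S,
      a ∈ (univ : Set (ι → EuclideanSpace ℝ (Fin n))) ×ˢ K →
      ∀ h, 0 < h → h ≤ s₀ → ∃ y ∈ K, dist y a.2 ≤ h * Metric.diam K ∧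
        ∀ i, c * h ^ m ≤ |sysPoly φ (a.1 i) y|) ⟨1, one_pos, 1, one_pos, by simp⟩ ?_ ?_ ?_
    · rintro S T hST ⟨c, hc, s₀, hs₀, H⟩
      exact ⟨c, hc, s₀, hs₀, fun a ha => H a (hST ha)⟩
    · rintro S T ⟨c, hc, s₀, hs₀, H⟩ ⟨c', hc', s₀', hs₀', H'⟩
      refine ⟨min c c', lt_min hc hc', min s₀ s₀', lt_min hs₀ hs₀', ?_⟩
      rintro a (ha | ha) haK h hh hhs
      · obtain ⟨y, hy, hd, hl⟩ := H a ha haK h hh (hhs.trans (min_le_left _ _))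
        refine ⟨y, hy, hd, fun i => le_trans ?_ (hl i)⟩
        gcongr
        exact min_le_left _ _
      · obtain ⟨y, hy, hd, hl⟩ := H' a ha haK h hh (hhs.trans (min_le_right _ _))
        refine ⟨y, hy, hd, fun i => le_trans ?_ (hl i)⟩
        gcongr
        exact min_le_right _ _
    · rintro ⟨q₀, x₀⟩ ⟨hq₀, hx₀⟩
      obtain ⟨z, hz, k, hkm, lam, hlam, s₀, hs₀, hs₁, hev⟩ :=
        exists_eventually_le_abs_iteratedFDeriv hKconv hKcomp hKint hφ hindep
          (fun i => Metric.ne_of_mem_sphere (hq₀ i (mem_univ i)) one_ne_zero) hx₀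
      refine ⟨_, nhdsWithin_mono _ (prod_mono_left (subset_univ _)) hev,
        lam * (1 / (2 * ((Fintype.card ι * 2 ^ m + 1 : ℕ) : ℝ))) ^ m, by positivity, s₀, hs₀, ?_⟩
      rintro ⟨q, x⟩ ha ⟨-, hx⟩ h hh hhs
      have hseg : ∀ s ∈ Icc 0 h, x + s • (z - x) ∈ K := fun s hs =>
        hKconv.add_smul_sub_mem hx hz ⟨hs.1, hs.2.trans (hhs.trans hs₁)⟩
      obtain ⟨s, hs, hl⟩ := exists_forall_le_abs_of_iterated_deriv hh
        (fun i j s => iteratedFDeriv ℝ j (sysPoly φ (q i)) (x + s • (z - x)) fun _ => z - x) k hkm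
        (fun i j s hs => hasDerivAt_iteratedFDeriv_comp_line
          (analyticOnNhd_sysPoly hφ (q i) _ (hseg s hs)).contDiffAt j)
        (fun i s hs => ha s ⟨hs.1, hs.2.trans hhs⟩ i)
      refine ⟨_, hseg s hs, ?_, fun i => ?_⟩
      · rw [dist_eq_norm, add_sub_cancel_left, norm_smul, Real.norm_of_nonneg hs.1,
          ← dist_eq_norm]
        exact mul_le_mul hs.2 (Metric.dist_le_diam_of_mem hKcomp.isBounded hz hx) dist_nonneg hh.le
      · have hi := hl i
        simp only [iteratedFDeriv_zero_apply] at hi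
        refine le_trans ?_ hi
        rw [mul_assoc, ← mul_pow, one_div_mul_eq_div]
        refine mul_le_mul_of_nonneg_left (pow_le_pow_of_le_one (by positivity) ?_ (hkm i)) hlam.le
        rw [div_le_one (by positivity)]
        have h1 : (1 : ℝ) ≤ ((Fintype.card ι * 2 ^ m + 1 : ℕ) : ℝ) := by
          exact_mod_cast Nat.le_add_left _ _
        linarith
  obtain ⟨c, hc, s₀, hs₀, H⟩ := key
  exact ⟨c, hc, s₀, hs₀, fun q hq x hx =>
    H (q, x) ⟨fun i _ => by simpa using hq i, hx⟩ ⟨mem_univ _, hx⟩⟩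

end System

/-! ### The regularization problem and the estimate -/

section System

variable {N n : ℕ} {K : Set (EuclideanSpace ℝ (Fin N))} {φ : Fin n → EuclideanSpace ℝ (Fin N) → ℝ}
  {f : EuclideanSpace ℝ (Fin N) → ℝ}

theorem exists_abs_eq_uniformNormOn {h : EuclideanSpace ℝ (Fin N) → ℝ} (hKcomp : IsCompact K)
    (hne : K.Nonempty) (hh : ContinuousOn h K) :
    ∃ x ∈ K, |h x| = uniformNormOn K h ∧ ∀ y ∈ K, |h y| ≤ |h x| := by
  obtain ⟨x, hx, hmax⟩ := hKcomp.exists_isMaxOn hne hh.abs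
  refine ⟨x, hx, ?_, fun y hy => hmax hy⟩
  refine (IsGreatest.csSup_eq (s := (fun x => |h x|) '' K) ⟨mem_image_of_mem _ hx, ?_⟩).symm
  rintro _ ⟨y, hy, rfl⟩
  exact hmax hy

/-- The coefficients of a polynomial by a linearly independent system are controlled by its
uniform norm. -/
theorem exists_norm_le_mul_of_abs_sysPoly_le (hKconv : Convex ℝ K) (hKcomp : IsCompact K)
    (hKint : (interior K).Nonempty) (hφ : ∀ i, AnalyticOnNhd ℝ (φ i) K)
    (hindep : LinearIndependent ℝ fun (i : Fin n) (x : K) => φ i x) :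
    ∃ B : ℝ, 0 ≤ B ∧ ∀ (c : EuclideanSpace ℝ (Fin n)) (R : ℝ), (∀ x ∈ K, |sysPoly φ c x| ≤ R) →
      ‖c‖ ≤ B * R := by
  obtain ⟨c₀, hc₀, s₀, hs₀, H⟩ :=
    exists_forall_exists_le_abs_sysPoly hKconv hKcomp hKint hφ hindep Unit
  obtain ⟨x, hx⟩ := hKint.mono interior_subset
  have hpos : 0 < c₀ * s₀ ^ maxZeroMultiplicity K φ := by positivity
  refine ⟨(c₀ * s₀ ^ maxZeroMultiplicity K φ)⁻¹, by positivity, fun c R hR => ?_⟩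
  have hR0 : 0 ≤ R := (abs_nonneg _).trans (hR x hx)
  by_cases hc : c = 0
  · rw [hc, norm_zero]; positivity
  have hcn : 0 < ‖c‖ := norm_pos_iff.2 hc
  -- At the fixed scale `h = s₀` the local bound is a lower bound for the uniform norm of a
  -- normalized polynomial.
  obtain ⟨y, hy, -, hle⟩ := H (fun _ => ‖c‖⁻¹ • c)
    (fun _ => by simp [norm_smul, inv_mul_cancel₀ hcn.ne']) x hx s₀ hs₀ le_rfl
  have hsm : sysPoly φ (‖c‖⁻¹ • c) y = ‖c‖⁻¹ * sysPoly φ c y := by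
    simp [sysPoly, Finset.mul_sum, mul_assoc]
  have h1 := hle ()
  rw [hsm, abs_mul, abs_of_pos (inv_pos.2 hcn), le_inv_mul_iff₀ hcn] at h1
  rw [le_inv_mul_iff₀ hpos, mul_comm]
  exact h1.trans (hR y hy)

theorem exists_abs_sysPoly_sub_le (hKconv : Convex ℝ K) (hKcomp : IsCompact K)
    (hφ : ∀ i, AnalyticOnNhd ℝ (φ i) K) :
    ∃ L : ℝ, 0 ≤ L ∧ ∀ (c : EuclideanSpace ℝ (Fin n)), ∀ x ∈ K, ∀ y ∈ K,
      |sysPoly φ c x - sysPoly φ c y| ≤ ‖c‖ * L * dist x y := by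
  have hlip : ∀ i, ∃ L, LipschitzOnWith L (φ i) K := fun i =>
    ContDiffOn.exists_lipschitzOnWith (n := 1)
      (fun x hx => (hφ i x hx).contDiffAt.contDiffWithinAt) one_ne_zero hKconv hKcomp
  choose L hL using hlip
  refine ⟨∑ i, (L i : ℝ), by positivity, fun c x hx y hy => ?_⟩
  have h1 : sysPoly φ c x - sysPoly φ c y = ∑ i, c i * (φ i x - φ i y) := by
    simp [sysPoly, mul_sub]
  rw [h1, Finset.mul_sum, Finset.sum_mul]
  refine (Finset.abs_sum_le_sum_abs _ _).trans (Finset.sum_le_sum fun i _ => ?_)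
  rw [abs_mul, mul_assoc]
  have h2 := (hL i).dist_le_mul x hx y hy
  rw [Real.dist_eq] at h2
  exact mul_le_mul (PiLp.norm_apply_le c i) h2 (abs_nonneg _) (norm_nonneg _)

/-- Inversion is continuous on `ℝ≥0∞`, including at `0`, so poles do not obstruct the existence of a
minimum. -/
theorem continuousOn_regObjective (hφ : ∀ i, AnalyticOnNhd ℝ (φ i) K)
    (q : Fin (n + 1) → Fin (n + 1) → EuclideanSpace ℝ (Fin n)) :
    ContinuousOn (regObjective φ q) K := by
  refine continuousOn_finsetSum _ fun i _ => continuous_inv.comp_continuousOn ?_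
  exact ENNReal.continuous_ofReal.comp_continuousOn
    ((analyticOnNhd_sysPoly hφ (q i.1 i.2)).continuousOn.abs.pow 2)

theorem IsStepData.le_uniformNormOn {t : Fin (n + 1) → EuclideanSpace ℝ (Fin N)}
    {σ : Fin (n + 1) → ℝ} {p : EuclideanSpace ℝ (Fin n)} {d : ℝ}
    (hstep : IsStepData K φ f t σ p d) (hKcomp : IsCompact K)
    (hcont : ContinuousOn (fun y => sysPoly φ p y - f y) K) :
    d ≤ uniformNormOn K fun y => sysPoly φ p y - f y := by
  obtain ⟨x, -, hx, hmax⟩ := exists_abs_eq_uniformNormOn hKcomp ⟨t 0, hstep.mem 0⟩ hcont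
  have h := hmax (t 0) (hstep.mem 0)
  rw [hx, hstep.interpolates 0, abs_mul] at h
  rcases hstep.sign 0 with hs | hs <;> rw [hs] at h <;>
    simpa [abs_of_nonneg hstep.nonneg] using h

theorem IsStepData.exists_isRegSolution {t : Fin (n + 1) → EuclideanSpace ℝ (Fin N)}
    {σ : Fin (n + 1) → ℝ} {p : EuclideanSpace ℝ (Fin n)} {d ν : ℝ}
    (hstep : IsStepData K φ f t σ p d) (hKcomp : IsCompact K)
    (hφ : ∀ i, AnalyticOnNhd ℝ (φ i) K) (hf : ContinuousOn f K) (hν : 0 ≤ ν)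
    (q : Fin (n + 1) → Fin (n + 1) → EuclideanSpace ℝ (Fin n)) :
    ∃ x, IsRegSolution K φ f p d ν q x := by
  have hcont : ContinuousOn (fun y => sysPoly φ p y - f y) K :=
    (analyticOnNhd_sysPoly hφ p).continuousOn.sub hf
  have hd := hstep.le_uniformNormOn hKcomp hcont
  obtain ⟨x, hxK, hx, -⟩ := exists_abs_eq_uniformNormOn hKcomp ⟨t 0, hstep.mem 0⟩ hcont
  set r := uniformNormOn K fun y => sysPoly φ p y - f y with hr
  have hfeas : IsCompact (regFeasible K φ f p ν r d) :=
    hKcomp.of_isClosed_subset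
      (hcont.abs.preimage_isClosed_of_isClosed hKcomp.isClosed isClosed_Ici) fun y hy => hy.1
  have hne : (regFeasible K φ f p ν r d).Nonempty := ⟨x, hxK, by rw [hx]; nlinarith⟩
  obtain ⟨y, hy, hmin⟩ := hfeas.exists_isMinOn hne
    ((continuousOn_regObjective hφ q).mono fun y hy => hy.1)
  exact ⟨y, hy, fun z hz => hmin hz⟩

/-- If the origin lies in the convex hull of the oriented moment vectors, then the deviation `d`
at the nodes is at most any bound of `|f|`. -/
theorem IsStepData.le_of_zero_mem_convexHull {t : Fin (n + 1) → EuclideanSpace ℝ (Fin N)}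
    {σ : Fin (n + 1) → ℝ} {p : EuclideanSpace ℝ (Fin n)} {d F : ℝ}
    (hstep : IsStepData K φ f t σ p d) (hF : ∀ x ∈ K, |f x| ≤ F)
    (h0 : 0 ∈ convexHull ℝ (range fun i => σ i • momentVec φ (t i))) : d ≤ F := by
  -- Pairing `p` with `σᵢ u(tᵢ)` gives `d + σᵢ f(tᵢ) ≥ d - F`; this half-space contains the hull,
  -- hence the origin.
  have hsub : convexHull ℝ (range fun i => σ i • momentVec φ (t i)) ⊆
      {v | d - F ≤ innerSL ℝ p v} := by
    refine convexHull_min ?_ (convex_halfSpace_ge (innerSL ℝ p).isLinear _)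
    rintro _ ⟨i, rfl⟩
    have h1 : innerSL ℝ p (σ i • momentVec φ (t i)) = σ i * sysPoly φ p (t i) := by
      simp [momentVec, sysPoly, PiLp.inner_apply, mul_comm]
    have h2 := hstep.interpolates i
    have h3 := abs_le.1 (hF (t i) (hstep.mem i))
    rw [mem_ofPred_eq, h1]
    rcases hstep.sign i with hs | hs <;> rw [hs] at h2 ⊢ <;> linarith
  have := hsub h0
  simp only [mem_ofPred_eq, map_zero] at this
  linarith

/-- A uniform lower bound for the polynomials of a nodal family gives an upper bound for the
objective. -/
theorem regObjective_le_of_le_abs {q : Fin (n + 1) → Fin (n + 1) → EuclideanSpace ℝ (Fin n)}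
    {y : EuclideanSpace ℝ (Fin N)} {b : ℝ} (hb : 0 < b)
    (h : ∀ i₁ i₂, i₁ < i₂ → b ≤ |sysPoly φ (q i₁ i₂) y|) :
    regObjective φ q y ≤ ENNReal.ofReal (((n + 1) ^ 2 : ℝ) * (b ^ 2)⁻¹) := by
  have hterm : ∀ i ∈ Finset.univ.filter fun i : Fin (n + 1) × Fin (n + 1) => i.1 < i.2,
      (ENNReal.ofReal (|sysPoly φ (q i.1 i.2) y| ^ 2))⁻¹ ≤ ENNReal.ofReal ((b ^ 2)⁻¹) := by
    intro i hi
    rw [ENNReal.ofReal_inv_of_pos (by positivity), ENNReal.inv_le_inv]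
    have := h i.1 i.2 (Finset.mem_filter.1 hi).2
    gcongr
  refine (Finset.sum_le_card_nsmul _ _ _ hterm).trans ?_
  rw [ENNReal.ofReal_mul (by positivity), nsmul_eq_mul]
  gcongr
  rw [show ((n : ℝ) + 1) ^ 2 = (((n + 1) ^ 2 : ℕ) : ℝ) by push_cast; ring, ENNReal.ofReal_natCast]
  gcongr
  refine (Finset.card_le_univ _).trans_eq ?_
  simp [sq]

theorem exists_regObjective_le_of_uniformNormOn_le (hKconv : Convex ℝ K) (hKcomp : IsCompact K)
    (hKint : (interior K).Nonempty) (hφ : ∀ i, AnalyticOnNhd ℝ (φ i) K)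
    (hindep : LinearIndependent ℝ fun (i : Fin n) (x : K) => φ i x)
    (hf : ∃ L, LipschitzOnWith L f K) {ν : ℝ} (hν : 0 < ν) (ρ : ℝ) :
    ∃ C : ℝ, ∀ t σ p d q, IsStepData K φ f t σ p d → IsNodalFamily φ t q →
      ∀ r : ℝ, r = uniformNormOn K (fun y => sysPoly φ p y - f y) → d < r → r ≤ ρ →
      ∀ x, IsRegSolution K φ f p d ν q x →
        regObjective φ q x ≤
          ENNReal.ofReal (C * |r - d| ^ (-2 * (maxZeroMultiplicity K φ : ℤ))) := by
  obtain ⟨Lf, hLf⟩ := hf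
  obtain ⟨c₀, hc₀, s₀, hs₀, H⟩ := exists_forall_exists_le_abs_sysPoly hKconv hKcomp hKint hφ hindep
    {i : Fin (n + 1) × Fin (n + 1) // i.1 < i.2}
  obtain ⟨B, hB, hcoef⟩ := exists_norm_le_mul_of_abs_sysPoly_le hKconv hKcomp hKint hφ hindep
  obtain ⟨L, hL, hlip⟩ := exists_abs_sysPoly_sub_le hKconv hKcomp hφ
  obtain ⟨F, hF⟩ := hKcomp.exists_bound_of_continuousOn hLf.continuousOn
  obtain ⟨x₀, hx₀⟩ := hKint.mono interior_subset
  have hF0 : 0 ≤ F := (norm_nonneg _).trans (hF x₀ hx₀)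
  set m := maxZeroMultiplicity K φ
  -- A Lipschitz constant for `p - f`, as `‖p‖ ≤ B * (|ρ| + F)`; the added `1`, here and in `D`,
  -- allows division.
  set L' : ℝ := B * (|ρ| + F) * L + Lf + 1 with hL'
  have hL'pos : 0 < L' := by positivity
  have hDnn : 0 ≤ Metric.diam K := Metric.diam_nonneg
  set D : ℝ := Metric.diam K + 1 with hD
  have hDpos : 0 < D := by positivity
  -- The first term limits the drop of `|p - f|` to `ν (r - d)`; the second keeps the scale `c₁ (r -
  -- d)` below `s₀`.
  set c₁ : ℝ := min (ν / (L' * D)) (s₀ / (|ρ| + 1)) with hc₁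
  have hc₁pos : 0 < c₁ := by positivity
  refine ⟨(n + 1) ^ 2 * ((c₀ * c₁ ^ m) ^ 2)⁻¹, ?_⟩
  intro t σ p d q hstep hq r hr hdr hrρ x hx
  have hcont : ContinuousOn (fun y => sysPoly φ p y - f y) K :=
    (analyticOnNhd_sysPoly hφ p).continuousOn.sub hLf.continuousOn
  obtain ⟨xm, hxm, hxr, hmax⟩ := exists_abs_eq_uniformNormOn hKcomp ⟨x₀, hx₀⟩ hcont
  rw [← hr] at hxr
  have hrd : 0 < r - d := sub_pos.2 hdr
  have hrd' : r - d ≤ |ρ| := by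
    have := hstep.nonneg
    have := le_abs_self ρ
    linarith
  have hp : ‖p‖ ≤ B * (|ρ| + F) := hcoef p _ fun y hy => by
    have h1 : |sysPoly φ p y - f y| ≤ r := hxr ▸ hmax y hy
    have h2 : |f y| ≤ F := hF y hy
    have h3 := abs_add_le (sysPoly φ p y - f y) (f y)
    rw [sub_add_cancel] at h3
    have := le_abs_self ρ
    linarith
  have hhpos : 0 < c₁ * (r - d) := by positivity
  have hhs : c₁ * (r - d) ≤ s₀ := calc
    c₁ * (r - d) ≤ s₀ / (|ρ| + 1) * (|ρ| + 1) := by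
      gcongr
      · exact min_le_right _ _
      · linarith
    _ = s₀ := by field_simp
  obtain ⟨y, hy, hdist, hlow⟩ := H (fun i => q i.1.1 i.1.2) (fun i => (hq _ _ i.2).1) xm hxm
    _ hhpos hhs
  have hchange : |(sysPoly φ p xm - f xm) - (sysPoly φ p y - f y)| ≤ ν * (r - d) := by
    have h1 := hlip p xm hxm y hy
    have h2 := hLf.dist_le_mul xm hxm y hy
    rw [Real.dist_eq] at h2
    have h3 := abs_sub (sysPoly φ p xm - sysPoly φ p y) (f xm - f y)
    rw [show sysPoly φ p xm - f xm - (sysPoly φ p y - f y) =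
      sysPoly φ p xm - sysPoly φ p y - (f xm - f y) by ring]
    have hdn : (0 : ℝ) ≤ dist xm y := dist_nonneg
    calc _ ≤ ‖p‖ * L * dist xm y + Lf * dist xm y := h3.trans (add_le_add h1 h2)
      _ ≤ B * (|ρ| + F) * L * dist xm y + Lf * dist xm y := by gcongr
      _ ≤ L' * dist xm y := by rw [hL']; nlinarith
      _ ≤ L' * (c₁ * (r - d) * D) := by
        gcongr
        rw [dist_comm]
        refine hdist.trans ?_
        gcongr
        rw [hD]; linarith
      _ ≤ L' * (ν / (L' * D) * (r - d) * D) := by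
        gcongr
        exact min_le_left _ _
      _ = ν * (r - d) := by field_simp
  have hyfeas : y ∈ regFeasible K φ f p ν (uniformNormOn K fun y => sysPoly φ p y - f y) d := by
    refine ⟨hy, ?_⟩
    rw [← hr]
    have h1 := abs_sub_abs_le_abs_sub (sysPoly φ p xm - f xm) (sysPoly φ p y - f y)
    have h2 : |sysPoly φ p xm - f xm| = r := hxr
    rw [h2] at h1
    linarith
  have hb : 0 < c₀ * (c₁ * (r - d)) ^ m := by positivity
  refine (hx.2 y hyfeas).trans ((regObjective_le_of_le_abs hb fun i₁ i₂ hi =>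
    hlow ⟨(i₁, i₂), hi⟩).trans_eq ?_)
  congr 1
  have hz : |r - d| ^ (-2 * (m : ℤ)) = (((r - d) ^ m) ^ 2)⁻¹ := by
    rw [abs_of_pos hrd, neg_mul, zpow_neg, mul_comm, zpow_mul]
    norm_cast
  rw [hz, mul_pow c₁, ← mul_assoc c₀, mul_pow _ ((r - d) ^ m), mul_inv, mul_assoc]

end System

theorem mainTheorem11 {N n : ℕ} (K : Set (EuclideanSpace ℝ (Fin N)))
    (hKconv : Convex ℝ K) (hKcomp : IsCompact K) (hKint : (interior K).Nonempty)
    (φ : Fin n → EuclideanSpace ℝ (Fin N) → ℝ)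
    (hφ : ∀ i, AnalyticOnNhd ℝ (φ i) K)
    (hindep : LinearIndependent ℝ fun (i : Fin n) (x : K) => φ i x)
    (f : EuclideanSpace ℝ (Fin N) → ℝ) (hf : ∃ L, LipschitzOnWith L f K)
    (ν : ℝ) (hν0 : 0 < ν) (hν1 : ν < 1) :
    -- the maximal multiplicity is finite
    BddAbove (zeroMultiplicities K φ) ∧
    -- the regularization problem has a solution
    (∀ t σ p d q, IsStepData K φ f t σ p d → IsNodalFamily φ t q →
      ∃ tν, IsRegSolution K φ f p d ν q tν) ∧
    -- the estimate, uniformly over all steps with bounded `r`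
    (∀ ρ : ℝ, ∃ C : ℝ, ∀ t σ p d q, IsStepData K φ f t σ p d → IsNodalFamily φ t q →
      ∀ r : ℝ, r = uniformNormOn K (fun y => sysPoly φ p y - f y) → d < r → r ≤ ρ →
      ∀ tν, IsRegSolution K φ f p d ν q tν →
        regObjective φ q tν ≤
          ENNReal.ofReal (C * |r - d| ^ (-2 * (maxZeroMultiplicity K φ : ℤ)))) ∧
    -- the estimate, uniformly over all steps of the algorithm with bounded `r - d`
    (∀ δ : ℝ, ∃ C : ℝ, ∀ t σ p d q, IsStepData K φ f t σ p d → IsNodalFamily φ t q →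
      0 ∈ convexHull ℝ (Set.range fun i => σ i • momentVec φ (t i)) →
      ∀ r : ℝ, r = uniformNormOn K (fun y => sysPoly φ p y - f y) → d < r → r - d ≤ δ →
      ∀ tν, IsRegSolution K φ f p d ν q tν →
        regObjective φ q tν ≤
          ENNReal.ofReal (C * |r - d| ^ (-2 * (maxZeroMultiplicity K φ : ℤ)))) := by
  obtain ⟨L, hL⟩ := id hf
  refine ⟨bddAbove_zeroMultiplicities hKconv hKcomp hφ hindep,
    fun t σ p d q hstep _ => hstep.exists_isRegSolution hKcomp hφ hL.continuousOn hν0.le q,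
    exists_regObjective_le_of_uniformNormOn_le hKconv hKcomp hKint hφ hindep hf hν0, fun δ => ?_⟩
  obtain ⟨F, hF⟩ := hKcomp.exists_bound_of_continuousOn hL.continuousOn
  -- Here `r ≤ δ + d ≤ δ + F`.
  obtain ⟨C, hC⟩ :=
    exists_regObjective_le_of_uniformNormOn_le hKconv hKcomp hKint hφ hindep hf hν0 (δ + F)
  refine ⟨C, fun t σ p d q hstep hq h0 r hr hdr hδ => hC t σ p d q hstep hq r hr hdr ?_⟩
  have hd := hstep.le_of_zero_mem_convexHull hF h0
  linarith
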